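/- A $\mathbb Z^2$-subshift is a closed, translation-invariant set $X\subseteq\mathcal A^{\mathbb Z^2}$, where $\mathcal A$ is a finite discrete alphabet; $\mathbb Z^2$ acts by $(T^u x)(v)=x(u+v)$. A set $S\subseteq\mathbb R^2$ *$X$-codes* $R\subseteq\mathbb R^2$ if any two $x,x'\in X$ that agree on $S\cap\mathbb Z^2$ also agree on $R\cap\mathbb Z^2$. A *convex integer polygon* is the convex hull in $\mathbb R^2$ of a finite set of at least two points of $\mathbb Z^2$ (a segment counts as a degenerate polygon, with two oriented edges). A convex integer polygon $\mathcal P$ is a *coding polygon* for $X$ if $\mathcal P\setminus\{v\}$ $X$-codes $\{v\}$ for every vertex $v$ of $\mathcal P$. An infinite subshift $X$ is *polygonal* if it has a coding polygon, and *triangular* if it has a coding polygon that is a triangle. A $\mathbb Z^2$-subshift $Y$ (over a finite alphabet $\mathcal A'$) is a *recoding* of $X$ if there are a finite set $F\subset\mathbb Z^2$ and a homeomorphism $\Psi\colon X\to Y$ commuting with the $\mathbb Z^2$-actions such that for all $p\in\mathbb Z^2$ and $x,x'\in X$ one has $\Psi(x)(p)=\Psi(x')(p)$ if and only if $x$ and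 $x'$ agree on $F+p$. Let $\mathcal P(X)$ be the set of all coding polygons of all recodings of $X$. A *minimal recoding polygon* for $X$ is an element of $\mathcal P(X)$ that has the least number of edges among all elements of $\mathcal P(X)$ and that is minimal under inclusion among the elements of $\mathcal P(X)$ with that number of edges. Two polygons are *homothetic* if one is the image of the other under $p\mapsto rp+w$ for some real $r>0$ and some $w\in\mathbb R^2$. **Corollary 5.15.** Let $X$ be a polygonal $\mathbb Z^2$-subshift. Then any two minimal recoding polygons for $X$ that are homothetic differ by a translation. In particular, if $X$ is triangular, any two minimal recoding polygons for $X$ differ by a translation. -/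

import Mathlib

open SymbolicDynamics.FullShift (Subshift shift)

namespace PolygonalShift

universe u v

/-- The inclusion of the lattice `ℤ²` into the plane `ℝ²`. -/
def toPlane (p : ℤ × ℤ) : ℝ × ℝ := ((p.1 : ℝ), (p.2 : ℝ))

/-- A region `S` of the plane `X`-codes a region `R` if any two colorings in `X` that agree on the
lattice points of `S` also agree on the lattice points of `R`. -/
def Codes {A : Type u} [TopologicalSpace A] (X : Subshift A (ℤ × ℤ)) (S R : Set (ℝ × ℝ)) : Prop :=
  ∀ x ∈ X.carrier, ∀ x' ∈ X.carrier,
    (∀ p : ℤ × ℤ, toPlane p ∈ S → x p = x' p) → ∀ p : ℤ × ℤ, toPlane p ∈ R → x p = x' p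

/-- `Y` is a recoding of `X` via the finite set `F ⊆ ℤ²`: there is an isomorphism `Ψ` of
`ℤ²`-shifts (a homeomorphism that commutes with all translations) from `X` to `Y` such that the
color of `Ψ x` at `p` and the restriction of `x` to `F + p` determine each other. -/
def IsRecodingVia {A : Type u} {B : Type v} [TopologicalSpace A] [TopologicalSpace B]
    (X : Subshift A (ℤ × ℤ)) (F : Finset (ℤ × ℤ)) (Y : Subshift B (ℤ × ℤ)) : Prop :=
  ∃ Ψ : X.carrier ≃ₜ Y.carrier,
    (∀ (w : ℤ × ℤ) (x : X.carrier),
      (Ψ ⟨shift w x.1, X.mapsTo w x.2⟩ : ℤ × ℤ → B) = shift w (Ψ x).1) ∧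
    ∀ (p : ℤ × ℤ) (x x' : X.carrier),
      (Ψ x).1 p = (Ψ x').1 p ↔ ∀ f ∈ F, x.1 (f + p) = x'.1 (f + p)

/-- `Y` is a recoding of `X` (via some finite subset of `ℤ²`). -/
def IsRecoding {A : Type u} {B : Type v} [TopologicalSpace A] [TopologicalSpace B]
    (X : Subshift A (ℤ × ℤ)) (Y : Subshift B (ℤ × ℤ)) : Prop :=
  ∃ F : Finset (ℤ × ℤ), IsRecodingVia X F Y

/-- A convex integer polygon: the convex hull in `ℝ²` of a finite set of at least two points of
`ℤ²`. A segment is allowed, as a degenerate polygon. -/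
def IsConvexIntegerPolygon (P : Set (ℝ × ℝ)) : Prop :=
  ∃ S : Finset (ℤ × ℤ), S.Nontrivial ∧ P = convexHull ℝ (toPlane '' (S : Set (ℤ × ℤ)))

/-- The vertices of a convex polygon are its extreme points. -/
def vertices (P : Set (ℝ × ℝ)) : Set (ℝ × ℝ) := Set.extremePoints ℝ P

/-- The number of edges of a convex polygon. Each vertex is the initial point of exactly one
(counterclockwise oriented) edge, so this is the number of vertices. A segment, traversed once in
each direction, has two oriented edges. -/
noncomputable def numEdges (P : Set (ℝ × ℝ)) : ℕ := (vertices P).ncard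

/-- `P` is a coding polygon for `X`: the color of each vertex `v` of `P` is determined by the colors
of all the other lattice points of `P`. -/
def IsCodingPolygon {A : Type u} [TopologicalSpace A] (X : Subshift A (ℤ × ℤ))
    (P : Set (ℝ × ℝ)) : Prop :=
  IsConvexIntegerPolygon P ∧ ∀ v ∈ vertices P, Codes X (P \ {v}) {v}

/-- An infinite `ℤ²`-subshift is polygonal if it has a coding polygon. -/
def IsPolygonal {A : Type u} [TopologicalSpace A] (X : Subshift A (ℤ × ℤ)) : Prop :=
  X.carrier.Infinite ∧ ∃ P, IsCodingPolygon X P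

/-- An infinite `ℤ²`-subshift is triangular if it has a coding polygon that is a triangle. -/
def IsTriangular {A : Type u} [TopologicalSpace A] (X : Subshift A (ℤ × ℤ)) : Prop :=
  X.carrier.Infinite ∧ ∃ P, IsCodingPolygon X P ∧ numEdges P = 3

/-- The class of all coding polygons of all recodings of `X`. The alphabets of the recodings are
arbitrary finite discrete spaces. -/
def recodingPolygons {A : Type u} [TopologicalSpace A] (X : Subshift A (ℤ × ℤ)) :
    Set (Set (ℝ × ℝ)) :=
  {P | ∃ (B : Type u) (_ : Finite B) (_ : TopologicalSpace B) (_ : DiscreteTopology B)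
      (Y : Subshift B (ℤ × ℤ)), IsRecoding X Y ∧ IsCodingPolygon Y P}

/-- A minimal recoding polygon of `X`: it has the least number of edges among all coding polygons
of recodings of `X`, and is minimal under inclusion among those with that number of edges. -/
def IsMinimalRecodingPolygon {A : Type u} [TopologicalSpace A] (X : Subshift A (ℤ × ℤ))
    (P : Set (ℝ × ℝ)) : Prop :=
  P ∈ recodingPolygons X ∧
    (∀ Q ∈ recodingPolygons X, numEdges P ≤ numEdges Q) ∧
    ∀ Q ∈ recodingPolygons X, numEdges Q = numEdges P → Q ⊆ P → Q = P

/-- `Q` is the image of `P` under `p ↦ r p + w`, for some ratio `r > 0` and some vector `w`. -/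
def Homothetic (P Q : Set (ℝ × ℝ)) : Prop :=
  ∃ r : ℝ, 0 < r ∧ ∃ w : ℝ × ℝ, Q = (fun p => r • p + w) '' P

/-- `Q` is a translate of `P`. -/
def DifferByTranslation (P Q : Set (ℝ × ℝ)) : Prop :=
  ∃ w : ℝ × ℝ, Q = (fun p => p + w) '' P

end PolygonalShift

namespace PolygonalShift

universe u v

/-! For the first claim, homothetic minimal recoding polygons can be named so that the ratio of the
homothety from `P` to `Q` is at most 1. Both have integer vertices, so an integer translation moves
a vertex of `Q` onto the corresponding vertex of `P`. The moved copy of `Q` is still a recoding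
polygon and, by convexity, lies in `P`; minimality forces equality
(`differByTranslation_of_le_one`).

For the triangular case it remains to show that all minimal recoding polygons are homothetic
triangles. The invariant is the set of nonzero integer normals `m` that are not deterministic: it is
unchanged by recoding (`IsRecoding.deterministic_iff`). A normal maximized at just one vertex of a
coding polygon is deterministic (`deterministic_of_unique_max`), whereas the edge normals of a
coding triangle never are when the subshift is infinite (`not_deterministic_outerNormal`). Hence a
coding polygon with at most three vertices of any other recoding attains each of the three edge
normals at least twice, which makes it a homothetic triangle (`homothetic_of_maximizers`). -/

/-- The integer linear functional on `ℤ²` with normal vector `m`. -/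
def form (m p : ℤ × ℤ) : ℤ := m.1 * p.1 + m.2 * p.2

theorem form_add (m p q : ℤ × ℤ) : form m (p + q) = form m p + form m q := by
  simp only [form, Prod.fst_add, Prod.snd_add]; ring

theorem form_sub (m p q : ℤ × ℤ) : form m (p - q) = form m p - form m q := by
  simp only [form, Prod.fst_sub, Prod.snd_sub]; ring

theorem form_nsmul (m p : ℤ × ℤ) (n : ℕ) : form m (n • p) = n * form m p := by
  simp [form]; ring

theorem form_neg_add (m n p : ℤ × ℤ) : form (-(m + n)) p = - form m p - form n p := by
  simp only [form, Prod.fst_neg, Prod.snd_neg, Prod.fst_add, Prod.snd_add]; ring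

/-! ### Deterministic half planes and their invariance under recoding -/

/-- The half plane `{m < 0}` determines the elements of `X`. -/
def Deterministic {A : Type u} [TopologicalSpace A] (X : Subshift A (ℤ × ℤ)) (m : ℤ × ℤ) : Prop :=
  ∀ x ∈ X.carrier, ∀ x' ∈ X.carrier, (∀ p, form m p < 0 → x p = x' p) → x = x'

section
variable {A : Type u} {B : Type v} [TopologicalSpace A] [TopologicalSpace B]

/-- Translating the hypothesis extends agreement by one level of `form m` at a time. -/
theorem deterministic_of_zero {X : Subshift A (ℤ × ℤ)} {m : ℤ × ℤ}
    (h : ∀ x ∈ X.carrier, ∀ x' ∈ X.carrier, (∀ p, form m p < 0 → x p = x' p) → x 0 = x' 0) :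
    Deterministic X m := by
  intro x hx x' hx' hag
  have key : ∀ n : ℕ, ∀ p, form m p < n → x p = x' p := by
    intro n
    induction n with
    | zero => simpa using hag
    | succ n ih =>
      intro p hp
      have := h (shift p x) (X.mapsTo p hx) (shift p x') (X.mapsTo p hx') (fun q hq => by
        refine ih (p + q) ?_
        rw [form_add]; push_cast at hp; omega)
      simpa [shift] using this
  funext p
  exact key ((form m p).toNat + 1) p (by omega)

/-- A large multiple of `w` carries `{m < 0}` into `{m < c}`; `w` also serves as a witness that `m`
is nonzero. -/
theorem Deterministic.of_lt {X : Subshift A (ℤ × ℤ)} {m w : ℤ × ℤ} (h : Deterministic X m)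
    (hw : form m w < 0) (c : ℤ) {x x' : ℤ × ℤ → A} (hx : x ∈ X.carrier) (hx' : x' ∈ X.carrier)
    (hag : ∀ p, form m p < c → x p = x' p) : x = x' := by
  have := h _ (X.mapsTo (c.natAbs • w) hx) _ (X.mapsTo (c.natAbs • w) hx') (fun p hp => by
    refine hag _ ?_
    rw [form_add, form_nsmul]
    have : (c.natAbs : ℤ) * form m w ≤ c.natAbs * (-1) := by
      apply mul_le_mul_of_nonneg_left <;> omega
    omega)
  funext p
  have := congrFun this (-(c.natAbs • w) + p)
  simpa [shift] using this

/-- Passing through the finite window `F` shifts a half plane by a bounded amount only, which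
`Deterministic.of_lt` absorbs. -/
theorem IsRecoding.deterministic_iff {X : Subshift A (ℤ × ℤ)} {Y : Subshift B (ℤ × ℤ)}
    (h : IsRecoding X Y) {m w : ℤ × ℤ} (hw : form m w < 0) :
    Deterministic X m ↔ Deterministic Y m := by
  obtain ⟨F, Ψ, -, hΨ⟩ := h
  constructor
  · intro hX y hy y' hy' hag
    obtain ⟨x, hxy⟩ := Ψ.surjective ⟨y, hy⟩
    obtain ⟨x', hxy'⟩ := Ψ.surjective ⟨y', hy'⟩
    have e : ∀ p, y p = y' p ↔ ∀ f ∈ F, x.1 (f + p) = x'.1 (f + p) := by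
      intro p
      rw [← hΨ, hxy, hxy']
    -- An empty window makes all points of `Y` equal; otherwise a single `f` recovers `x` on a
    -- translated half plane.
    rcases F.eq_empty_or_nonempty with hF | ⟨f, hf⟩
    · funext p
      rw [e]; simp [hF]
    · have : x = x' := by
        refine Subtype.ext (hX.of_lt hw (form m f) x.2 x'.2 fun p hp => ?_)
        have := (e (p - f)).1 (hag _ (by rw [form_sub]; omega)) f hf
        simpa using this
      have := hxy.symm.trans ((congrArg Ψ this).trans hxy')
      simpa using this
  · intro hY x hx x' hx' hag
    obtain ⟨M, hM⟩ : ∃ M : ℤ, ∀ f ∈ F, form m f ≤ M := by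
      obtain ⟨M, hM⟩ := (F.image (form m)).bddAbove
      exact ⟨M, fun f hf => hM (by simpa using ⟨f.1, f.2, hf, rfl⟩)⟩
    have : Ψ ⟨x, hx⟩ = Ψ ⟨x', hx'⟩ := by
      refine Subtype.ext (hY.of_lt hw (-M) (Ψ _).2 (Ψ _).2 fun p hp => ?_)
      rw [hΨ]
      intro f hf
      refine hag _ ?_
      rw [form_add]
      have := hM f hf
      omega
    simpa using Ψ.injective this

theorem IsRecoding.infinite {X : Subshift A (ℤ × ℤ)} {Y : Subshift B (ℤ × ℤ)}
    (h : IsRecoding X Y) (hX : X.carrier.Infinite) : Y.carrier.Infinite := by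
  obtain ⟨F, Ψ, -⟩ := h
  have := hX.to_subtype
  exact Set.infinite_coe_iff.1 (Infinite.of_injective Ψ Ψ.injective)

theorem IsRecoding.refl (X : Subshift A (ℤ × ℤ)) : IsRecoding X X :=
  ⟨{0}, Homeomorph.refl _, fun _ _ => rfl, fun p x x' => by simp⟩

/-- Compactness: if every finite part of the half plane failed, a limit of the counterexample pairs
would agree on the whole half plane and still differ at `0`. -/
theorem Deterministic.exists_finset [Finite A] [DiscreteTopology A] {X : Subshift A (ℤ × ℤ)}
    {m : ℤ × ℤ} (h : Deterministic X m) :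
    ∃ K : Finset (ℤ × ℤ), (∀ k ∈ K, form m k < 0) ∧
      ∀ x ∈ X.carrier, ∀ x' ∈ X.carrier, (∀ k ∈ K, x k = x' k) → x 0 = x' 0 := by
  classical
  by_contra! hK
  let s : Set ((ℤ × ℤ → A) × (ℤ × ℤ → A)) :=
    (X.carrier ×ˢ X.carrier) ∩ {z | z.1 0 ≠ z.2 0}
  have hne : IsClosed {z : (ℤ × ℤ → A) × (ℤ × ℤ → A) | z.1 0 ≠ z.2 0} :=
    (isClosed_discrete {q : A × A | q.1 ≠ q.2}).preimage
      (f := fun z : (ℤ × ℤ → A) × (ℤ × ℤ → A) => (z.1 0, z.2 0)) (by fun_prop)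
  have hs : IsCompact s := ((X.isClosed.prod X.isClosed).inter hne).isCompact
  obtain ⟨z, hz, hz'⟩ := hs.inter_iInter_nonempty
    (fun p : {p : ℤ × ℤ // form m p < 0} => {z | z.1 p.1 = z.2 p.1})
    (fun p => isClosed_eq (by fun_prop) (by fun_prop)) (fun u => by
      obtain ⟨x, hx, x', hx', hag, hn⟩ := hK (u.image Subtype.val) (by simp; tauto)
      refine ⟨(x, x'), ⟨⟨hx, hx'⟩, hn⟩, ?_⟩
      simp only [Set.mem_iInter]
      exact fun p hp => hag p.1 (Finset.mem_image_of_mem _ hp))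
  refine hz.2 (congrFun (h _ hz.1.1 _ hz.1.2 fun p hp => ?_) 0)
  exact Set.mem_iInter.1 hz' ⟨p, hp⟩

/-! ### Finiteness criterion for a deterministic edge normal -/

/-- If a finite set determines a region that contains translates of all finite sets,
the subshift is finite. -/
theorem finite_of_finite_codes [Finite A] {X : Subshift A (ℤ × ℤ)} (D C : Set (ℤ × ℤ))
    (hD : D.Finite)
    (hDC : ∀ x ∈ X.carrier, ∀ x' ∈ X.carrier, (∀ p ∈ D, x p = x' p) → ∀ p ∈ C, x p = x' p)
    (hC : ∀ E : Finset (ℤ × ℤ), ∃ w : ℤ × ℤ, ∀ e ∈ E, w + e ∈ C) : X.carrier.Finite := by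
  classical
  by_contra hinf
  have := hD.to_subtype
  have := Fintype.ofFinite (D → A)
  -- Pigeonhole: one more point than there are patterns on `D`. The finitely many sites separating
  -- pairs in `t` are translated into `C`.
  obtain ⟨t, ht, hcard⟩ := Set.Infinite.exists_subset_card_eq hinf (Fintype.card (D → A) + 1)
  have hsep : ∀ z : (ℤ × ℤ → A) × (ℤ × ℤ → A), ∃ p, z.1 ≠ z.2 → z.1 p ≠ z.2 p := by
    intro z
    by_cases hz : z.1 = z.2
    · exact ⟨0, fun h => absurd hz h⟩
    · obtain ⟨p, hp⟩ := Function.ne_iff.1 hz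
      exact ⟨p, fun _ => hp⟩
  choose d hd using hsep
  obtain ⟨w, hw⟩ := hC ((t ×ˢ t).image d)
  obtain ⟨x, hx, x', hx', hne, heq⟩ := Finset.exists_ne_map_eq_of_card_lt_of_maps_to
    (s := t) (t := (Finset.univ : Finset (D → A)))
    (f := fun x p => x (-w + p.1)) (by simp [hcard]) (fun _ _ => by simp)
  have := hDC _ (X.mapsTo (-w) (ht hx)) _ (X.mapsTo (-w) (ht hx'))
    (fun p hp => congrFun heq ⟨p, hp⟩) _
    (hw _ (Finset.mem_image_of_mem d (Finset.mk_mem_product hx hx')))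
  exact hd (x, x') hne (by simpa [shift] using this)

theorem eq_at_of_codes_vertex {X : Subshift A (ℤ × ℤ)} {W : Set (ℤ × ℤ)} {a : ℤ × ℤ}
    (ha : ∀ x ∈ X.carrier, ∀ x' ∈ X.carrier, (∀ q ∈ W, q ≠ a → x q = x' q) → x a = x' a)
    {x x' : ℤ × ℤ → A} (hx : x ∈ X.carrier) (hx' : x' ∈ X.carrier) (p : ℤ × ℤ)
    (hag : ∀ q ∈ W, q ≠ a → x (p + (q - a)) = x' (p + (q - a))) : x p = x' p := by
  have := ha _ (X.mapsTo (p - a) hx) _ (X.mapsTo (p - a) hx') (fun q hq hqa => by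
    have := hag q hq hqa
    rw [show p + (q - a) = p - a + q by abel] at this
    exact this)
  simpa [shift] using this

/-- The key finiteness criterion. The region `W` (a triangle) codes two of its corners `a` and `b`,
which are joined by the edge with outer normal `-(m + n)`, the other edges at `a` and `b` having
outer normals `m` and `n`. If the normal `-(m + n)` is deterministic, then the subshift is finite:
a large trapezoid codes an infinite cone. -/
theorem finite_of_deterministic [Finite A] [DiscreteTopology A] {X : Subshift A (ℤ × ℤ)}
    {W : Set (ℤ × ℤ)} {a b m n w : ℤ × ℤ}
    (ha : ∀ x ∈ X.carrier, ∀ x' ∈ X.carrier, (∀ q ∈ W, q ≠ a → x q = x' q) → x a = x' a)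
    (hb : ∀ x ∈ X.carrier, ∀ x' ∈ X.carrier, (∀ q ∈ W, q ≠ b → x q = x' q) → x b = x' b)
    (hm : ∀ q ∈ W, form m q ≤ form m a) (hn : ∀ q ∈ W, form n q ≤ form n b)
    (hab : form m a + form n a = form m b + form n b)
    (hW : ∀ q ∈ W, form m a + form n a ≤ form m q + form n q)
    (hinj : ∀ p q, form m p = form m q → form n p = form n q → p = q)
    (hwm : form m w < 0) (hwn : form n w < 0)
    (hdet : Deterministic X (-(m + n))) : X.carrier.Finite := by
  obtain ⟨K, hK, hKX⟩ := hdet.exists_finset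
  obtain ⟨M, hM0, hM⟩ : ∃ M : ℤ, 0 ≤ M ∧ ∀ k ∈ K, form m k ≤ M ∧ form n k ≤ M := by
    obtain ⟨M₁, h₁⟩ := (K.image (form m)).bddAbove
    obtain ⟨M₂, h₂⟩ := (K.image (form n)).bddAbove
    refine ⟨max 0 (max M₁ M₂), by simp, fun k hk => ⟨?_, ?_⟩⟩
    · exact (h₁ (by simpa using ⟨k.1, k.2, hk, rfl⟩)).trans (by simp)
    · exact (h₂ (by simpa using ⟨k.1, k.2, hk, rfl⟩)).trans (by simp)
  obtain ⟨L, hL⟩ : ∃ L : ℤ, L = form n b - form n a := ⟨_, rfl⟩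
  -- `M` bounds how far the window `K` protrudes towards either side of the cone, and `|L|` is the
  -- extent of the edge `ab`. With this `N`, a point within `M` of one side of a row at depth beyond
  -- `N` is so far from the other side that a copy of `W` attached there stays inside the cone.
  obtain ⟨N, hN⟩ : ∃ N : ℤ, N = 2 * M + |L| := ⟨_, rfl⟩
  have hLabs := le_abs_self L
  have hLnn := abs_nonneg L
  refine finite_of_finite_codes {p | form m p ≤ 0 ∧ form n p ≤ 0 ∧ -N ≤ form m p + form n p}
    {p | form m p ≤ 0 ∧ form n p ≤ 0} ?_ ?_ ?_
  · refine Set.Finite.of_finite_image (f := fun p => (form m p, form n p)) ?_ ?_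
    · refine ((Set.finite_Icc (-N) 0).prod (Set.finite_Icc (-N) 0)).subset ?_
      rintro _ ⟨p, ⟨h1, h2, h3⟩, rfl⟩
      simp only [Set.mem_prod, Set.mem_Icc]
      omega
    · intro p _ q _ h
      exact hinj p q (congrArg Prod.fst h) (congrArg Prod.snd h)
  · intro x hx x' hx' hag
    have key : ∀ j : ℕ, ∀ p, form m p ≤ 0 → form n p ≤ 0 → -(N + j) ≤ form m p + form n p →
        x p = x' p := by
      intro j
      induction j with
      | zero => exact fun p h1 h2 h3 => hag p ⟨h1, h2, by simpa using h3⟩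
      | succ j ih =>
        -- Each new row is parallel to `ab`. Its middle comes from the rows nearer the apex through
        -- `K`; the known stretch then grows by one level of `form m` and `form n` towards both
        -- sides.
        have row : ∀ i : ℕ, ∀ p, form m p ≤ 0 → form n p ≤ 0 →
            form m p + form n p = -(N + (j + 1)) → form m p ≤ -M + i → form n p ≤ -M + i →
            x p = x' p := by
          intro i
          induction i with
          | zero =>
            intro p h1 h2 h3 h4 h5
            have := hKX _ (X.mapsTo p hx) _ (X.mapsTo p hx') (fun k hk => by
              have h6 := hK k hk
              rw [form_neg_add] at h6
              have h7 := hM k hk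
              push_cast at h4 h5
              refine ih (p + k) ?_ ?_ ?_ <;> simp only [form_add] <;> omega)
            simpa [shift] using this
          | succ i ihrow =>
            intro p h1 h2 h3 h4 h5
            push_cast at h4 h5
            have step : ∀ q, form m q ≤ 0 → form n q ≤ 0 →
                -(N + (j + 1)) ≤ form m q + form n q →
                (form m q + form n q = -(N + (j + 1)) → form m q ≤ -M + i ∧ form n q ≤ -M + i) →
                x q = x' q := by
              intro q g1 g2 g3 g4
              rcases g3.eq_or_lt with g | g
              · exact ihrow q g1 g2 g.symm (g4 g.symm).1 (g4 g.symm).2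
              · exact ih q g1 g2 (by omega)
            by_cases c1 : form m p ≤ -M + i
            · by_cases c2 : form n p ≤ -M + i
              · exact ihrow p h1 h2 h3 c1 c2
              -- Here `p` is the next site towards the side `n = 0`. Placing `b` at `p` puts the
              -- rest of `W` in earlier rows or in the known stretch of this row.
              refine eq_at_of_codes_vertex hb hx hx' p fun q hq hqb => ?_
              have e1 := hm q hq
              have e2 := hn q hq
              have e3 := hW q hq
              have e4 : ¬ (form m q = form m b ∧ form n q = form n b) :=
                fun h => hqb (hinj _ _ h.1 h.2)
              refine step _ ?_ ?_ ?_ ?_ <;> simp only [form_add, form_sub] <;> omega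
            · refine eq_at_of_codes_vertex ha hx hx' p fun q hq hqa => ?_
              have e1 := hm q hq
              have e2 := hn q hq
              have e3 := hW q hq
              have e4 : ¬ (form m q = form m a ∧ form n q = form n a) :=
                fun h => hqa (hinj _ _ h.1 h.2)
              refine step _ ?_ ?_ ?_ ?_ <;> simp only [form_add, form_sub] <;> omega
        intro p h1 h2 h3
        rcases h3.eq_or_lt with h | h
        -- After `M` extensions the bounds read `form m p ≤ 0` and `form n p ≤ 0`, so the whole row
        -- is covered.
        · exact row M.toNat p h1 h2 (by push_cast at h; omega) (by omega) (by omega)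
        · exact ih p h1 h2 (by push_cast at h; omega)
    intro p hp
    exact key (-(form m p + form n p)).toNat p hp.1 hp.2 (by omega)
  · intro E
    obtain ⟨M₁, h₁⟩ := (E.image (form m)).bddAbove
    obtain ⟨M₂, h₂⟩ := (E.image (form n)).bddAbove
    refine ⟨(M₁.natAbs + M₂.natAbs) • w, fun e he => ?_⟩
    have g1 : form m e ≤ M₁ := h₁ (by simpa using ⟨e.1, e.2, he, rfl⟩)
    have g2 : form n e ≤ M₂ := h₂ (by simpa using ⟨e.1, e.2, he, rfl⟩)
    have g3 : ((M₁.natAbs + M₂.natAbs : ℕ) : ℤ) * form m w ≤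
        ((M₁.natAbs + M₂.natAbs : ℕ) : ℤ) * (-1) :=
      mul_le_mul_of_nonneg_left (by omega) (by omega)
    have g4 : ((M₁.natAbs + M₂.natAbs : ℕ) : ℤ) * form n w ≤
        ((M₁.natAbs + M₂.natAbs : ℕ) : ℤ) * (-1) :=
      mul_le_mul_of_nonneg_left (by omega) (by omega)
    simp only [Set.mem_ofPred_eq, form_add, form_nsmul]
    omega
end

/-! ### Convex integer polygons, their vertices and maximizers -/

theorem toPlane_injective : Function.Injective toPlane := by
  intro p q h
  simp only [toPlane, Prod.mk.injEq, Int.cast_inj] at h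
  exact Prod.ext h.1 h.2

theorem toPlane_add (p q : ℤ × ℤ) : toPlane (p + q) = toPlane p + toPlane q := by
  simp [toPlane]

/-- The real linear functional on the plane with integer normal vector `m`. -/
def planeForm (m : ℤ × ℤ) : ℝ × ℝ →ₗ[ℝ] ℝ :=
  (m.1 : ℝ) • LinearMap.fst ℝ ℝ ℝ + (m.2 : ℝ) • LinearMap.snd ℝ ℝ ℝ

theorem planeForm_toPlane (m p : ℤ × ℤ) : planeForm m (toPlane p) = form m p := by
  simp [planeForm, toPlane, form]

theorem form_le_of_mem_convexHull {V : Set (ℤ × ℤ)} {m p : ℤ × ℤ} {c : ℤ}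
    (h : ∀ v ∈ V, form m v ≤ c) (hp : toPlane p ∈ convexHull ℝ (toPlane '' V)) :
    form m p ≤ c := by
  have : convexHull ℝ (toPlane '' V) ⊆ {z | planeForm m z ≤ c} := by
    refine convexHull_min ?_ (convex_halfSpace_le (planeForm m).isLinear _)
    rintro _ ⟨v, hv, rfl⟩
    simpa [planeForm_toPlane] using h v hv
  simpa [planeForm_toPlane] using this hp

/-- An open half plane together with one point of its boundary line is convex. -/
theorem form_lt_of_mem_convexHull {V : Set (ℤ × ℤ)} {m p a : ℤ × ℤ}
    (h : ∀ v ∈ V, v ≠ a → form m v < form m a) (hp : toPlane p ∈ convexHull ℝ (toPlane '' V))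
    (hpa : p ≠ a) : form m p < form m a := by
  have : convexHull ℝ (toPlane '' V) ⊆
      {z | z = toPlane a ∨ planeForm m z < planeForm m (toPlane a)} := by
    refine convexHull_min ?_ ?_
    · rintro _ ⟨v, hv, rfl⟩
      by_cases hva : v = a
      · exact Or.inl (by rw [hva])
      · right
        simpa [planeForm_toPlane] using h v hv hva
    · intro y hy z hz s t hs ht hst
      rcases hs.eq_or_lt with rfl | hs
      · obtain rfl : t = 1 := by linarith
        simpa using hz
      rcases ht.eq_or_lt with rfl | ht
      · obtain rfl : s = 1 := by linarith
        simpa using hy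
      obtain rfl : s = 1 - t := by linarith
      rcases hy with rfl | hy <;> rcases hz with rfl | hz
      · left; rw [← add_smul]; simp
      all_goals
        right
        simp only [map_add, map_smul, smul_eq_mul]
        nlinarith
  rcases this hp with h | h
  · exact absurd (toPlane_injective h) hpa
  · simpa [planeForm_toPlane] using h

/-- Extreme points of a hull lie in the generating set, hence are integral, and Krein–Milman
recovers the polygon from them; finiteness makes the closure superfluous. -/
theorem IsConvexIntegerPolygon.exists_finset {P : Set (ℝ × ℝ)} (hP : IsConvexIntegerPolygon P) :
    ∃ V : Finset (ℤ × ℤ), vertices P = toPlane '' V ∧ P = convexHull ℝ (toPlane '' V) ∧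
      V.Nonempty ∧ V.card = numEdges P := by
  classical
  obtain ⟨S, hS, hPS⟩ := hP
  have hsub : vertices P ⊆ toPlane '' S := by
    rw [vertices, hPS]; exact extremePoints_convexHull_subset
  obtain ⟨V, hV⟩ : ∃ V, V = S.filter fun p => toPlane p ∈ vertices P := ⟨_, rfl⟩
  have hV' : vertices P = toPlane '' V := by
    ext z
    constructor
    · intro hz
      obtain ⟨p, hp, rfl⟩ := hsub hz
      exact ⟨p, by simpa [hV] using ⟨hp, hz⟩, rfl⟩
    · rintro ⟨p, hp, rfl⟩
      rw [hV] at hp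
      exact (Finset.mem_filter.1 hp).2
  have hfin := S.finite_toSet.image toPlane
  have hPV : P = convexHull ℝ (toPlane '' V) := by
    have h := closure_convexHull_extremePoints (s := P)
      (hPS ▸ hfin.isCompact_convexHull ℝ) (hPS ▸ convex_convexHull ℝ _)
    rw [← hV']
    exact h.symm.trans ((hfin.subset hsub).isClosed_convexHull ℝ).closure_eq
  refine ⟨V, hV', hPV, ?_, ?_⟩
  · rw [Finset.nonempty_iff_ne_empty]
    intro hV0
    obtain ⟨p, hp⟩ := hS.nonempty
    have : toPlane p ∈ P := hPS ▸ subset_convexHull ℝ _ (Set.mem_image_of_mem _ hp)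
    simp [hPV, hV0] at this
  · rw [numEdges, hV', Set.ncard_image_of_injective _ toPlane_injective, Set.ncard_coe_finset]

theorem codes_vertex {A : Type u} [TopologicalSpace A] {X : Subshift A (ℤ × ℤ)}
    {V : Set (ℤ × ℤ)} {P : Set (ℝ × ℝ)} (hP : IsCodingPolygon X P)
    (hV : vertices P = toPlane '' V) {a : ℤ × ℤ} (ha : a ∈ V) :
    ∀ x ∈ X.carrier, ∀ x' ∈ X.carrier,
      (∀ q ∈ {q | toPlane q ∈ P}, q ≠ a → x q = x' q) → x a = x' a := by
  intro x hx x' hx' hag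
  refine hP.2 (toPlane a) (hV ▸ Set.mem_image_of_mem _ ha) x hx x' hx' (fun p hp => ?_) a rfl
  exact hag p hp.1 fun h => hp.2 (by rw [h]; rfl)

/-- A normal that attains its maximum over a coding polygon at a single vertex is deterministic. -/
theorem deterministic_of_unique_max {A : Type u} [TopologicalSpace A] {X : Subshift A (ℤ × ℤ)}
    {V : Set (ℤ × ℤ)} {P : Set (ℝ × ℝ)} (hP : IsCodingPolygon X P)
    (hV : vertices P = toPlane '' V) (hPV : P = convexHull ℝ (toPlane '' V)) {a m : ℤ × ℤ}
    (ha : a ∈ V) (h : ∀ v ∈ V, v ≠ a → form m v < form m a) : Deterministic X m := by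
  refine deterministic_of_zero fun x hx x' hx' hag => ?_
  refine eq_at_of_codes_vertex (codes_vertex hP hV ha) hx hx' 0 fun q hq hqa => hag _ ?_
  have := form_lt_of_mem_convexHull h (hPV ▸ hq) hqa
  rw [zero_add, form_sub]
  omega

theorem exists_two_max_of_not_deterministic {A : Type u} [TopologicalSpace A]
    {X : Subshift A (ℤ × ℤ)} {V : Finset (ℤ × ℤ)} {P : Set (ℝ × ℝ)} (hP : IsCodingPolygon X P)
    (hV : vertices P = toPlane '' V) (hPV : P = convexHull ℝ (toPlane '' V)) (hne : V.Nonempty)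
    {m : ℤ × ℤ} (hm : ¬ Deterministic X m) :
    1 < (V.filter fun p => ∀ v ∈ V, form m v ≤ form m p).card := by
  obtain ⟨a, ha, hmax⟩ := V.exists_max_image (form m) hne
  by_contra! hcard
  refine hm (deterministic_of_unique_max hP hV hPV (a := a) ha fun v hv hva => ?_)
  refine lt_of_le_of_ne (hmax v hv) fun heq => hva ?_
  exact Finset.card_le_one.1 hcard v (by simp_all) a (by simp_all)

/-! ### Triangles and their edge normals -/

/-- The determinant of `b - a` and `c - a`. -/
def orient (a b c : ℤ × ℤ) : ℤ := (b.1 - a.1) * (c.2 - a.2) - (b.2 - a.2) * (c.1 - a.1)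

/-- Of three distinct collinear points one lies strictly between the others, so it is not extreme.
-/
theorem orient_ne_zero {a b c : ℤ × ℤ} {P : Set (ℝ × ℝ)} (hab : a ≠ b) (hac : a ≠ c) (hbc : b ≠ c)
    (hV : vertices P = toPlane '' {a, b, c}) : orient a b c ≠ 0 := by
  intro h0
  have hcol : Collinear ℝ {toPlane a, toPlane b, toPlane c} := by
    rw [collinear_iff_of_mem (p₀ := toPlane a) (by simp)]
    refine ⟨toPlane b - toPlane a, ?_⟩
    have h0' : ((b.1 : ℝ) - a.1) * (c.2 - a.2) = (b.2 - a.2) * (c.1 - a.1) := by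
      have : (orient a b c : ℝ) = 0 := by exact_mod_cast h0
      simp only [orient] at this; push_cast at this; linarith
    have hc : ∃ r : ℝ, toPlane c = r • (toPlane b - toPlane a) + toPlane a := by
      by_cases h1 : (b.1 : ℝ) - a.1 = 0
      · have h2 : (b.2 : ℝ) - a.2 ≠ 0 := by
          intro h2
          refine hab (toPlane_injective (Prod.ext ?_ ?_)) <;> simp only [toPlane] <;> linarith
        refine ⟨(c.2 - a.2) / (b.2 - a.2), ?_⟩
        refine Prod.ext ?_ ?_ <;> simp [toPlane]
        · rw [h1] at h0' ⊢
          have : (c.1 : ℝ) - a.1 = 0 := by simpa [h2] using h0'.symm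
          linarith
        · field_simp; ring
      · refine ⟨(c.1 - a.1) / (b.1 - a.1), ?_⟩
        refine Prod.ext ?_ ?_ <;> simp [toPlane]
        · field_simp; ring
        · field_simp; linarith
    simp only [Set.mem_insert_iff, Set.mem_singleton_iff, forall_eq_or_imp, forall_eq]
    exact ⟨⟨0, by simp⟩, ⟨1, by simp⟩, hc⟩
  have key : ∀ x y z : ℤ × ℤ, x ≠ y → y ≠ z → x ∈ ({a, b, c} : Set (ℤ × ℤ)) →
      y ∈ ({a, b, c} : Set (ℤ × ℤ)) → z ∈ ({a, b, c} : Set (ℤ × ℤ)) →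
      ¬ Wbtw ℝ (toPlane x) (toPlane y) (toPlane z) := by
    intro x y z hxy hyz hx hy hz hw
    have hx := hV ▸ Set.mem_image_of_mem toPlane hx
    have hy := hV ▸ Set.mem_image_of_mem toPlane hy
    have hz := hV ▸ Set.mem_image_of_mem toPlane hz
    have hseg := mem_openSegment_of_ne_left_right (toPlane_injective.ne hxy)
      (toPlane_injective.ne hyz.symm) (mem_segment_iff_wbtw.2 hw)
    exact hxy (toPlane_injective (hy.2 hx.1 hz.1 hseg))
  rcases hcol.wbtw_or_wbtw_or_wbtw with h | h | h
  · exact key _ _ _ hab hbc (by simp) (by simp) (by simp) h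
  · exact key _ _ _ hbc hac.symm (by simp) (by simp) (by simp) h
  · exact key _ _ _ hac.symm hab (by simp) (by simp) (by simp) h

/-- An outer normal of the triangle `abc` at the edge `ab`. -/
def outerNormal (a b c : ℤ × ℤ) : ℤ × ℤ :=
  (orient a b c * (b.2 - a.2), - orient a b c * (b.1 - a.1))

/-- At `p = c` the drop is the square of `orient a b c`: the factor in `outerNormal` makes the
normal point outward for either orientation. -/
theorem form_outerNormal (a b c p : ℤ × ℤ) :
    form (outerNormal a b c) p = form (outerNormal a b c) a - orient a b c * orient a b p := by
  simp only [form, outerNormal, orient]; ring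

theorem form_outerNormal_right (a b c : ℤ × ℤ) :
    form (outerNormal a b c) b = form (outerNormal a b c) a := by
  rw [form_outerNormal _ _ _ b]; simp only [orient]; ring

/-- The edge vectors of a triangle sum to zero, hence so do the outer normals; this matches the
shape `-(m + n)` of `finite_of_deterministic`. -/
theorem outerNormal_eq_neg (a b c : ℤ × ℤ) :
    outerNormal a b c = -(outerNormal a c b + outerNormal b c a) := by
  ext <;> simp only [outerNormal, orient, Prod.fst_neg, Prod.snd_neg, Prod.fst_add,
    Prod.snd_add] <;> ring

theorem orient_swap (a b c : ℤ × ℤ) : orient a c b = - orient a b c := by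
  simp only [orient]; ring

theorem orient_rotate (a b c : ℤ × ℤ) : orient b c a = orient a b c := by
  simp only [orient]; ring

theorem outerNormal_injective {a b c p q : ℤ × ℤ} (h0 : orient a b c ≠ 0)
    (h₁ : form (outerNormal a c b) p = form (outerNormal a c b) q)
    (h₂ : form (outerNormal b c a) p = form (outerNormal b c a) q) : p = q := by
  have h3 : orient a b c ^ 2 ≠ 0 := pow_ne_zero _ h0
  have e1 : orient a b c ^ 2 * (p.1 - q.1) = 0 := by
    have : orient a b c * (orient a b c * (p.1 - q.1)) =
      (c.1 - b.1) * (form (outerNormal a c b) p - form (outerNormal a c b) q) +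
      (c.1 - a.1) * (form (outerNormal b c a) p - form (outerNormal b c a) q) := by
      simp only [form, outerNormal, orient]; ring
    rw [h₁, h₂] at this
    linarith
  have e2 : orient a b c ^ 2 * (p.2 - q.2) = 0 := by
    have : orient a b c * (orient a b c * (p.2 - q.2)) =
      (c.2 - b.2) * (form (outerNormal a c b) p - form (outerNormal a c b) q) +
      (c.2 - a.2) * (form (outerNormal b c a) p - form (outerNormal b c a) q) := by
      simp only [form, outerNormal, orient]; ring
    rw [h₁, h₂] at this
    linarith
  simp only [mul_eq_zero, h3, false_or] at e1 e2
  ext <;> omega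

theorem not_deterministic_outerNormal {A : Type u} [Finite A] [TopologicalSpace A]
    [DiscreteTopology A] {X : Subshift A (ℤ × ℤ)} (hX : X.carrier.Infinite) {a b c : ℤ × ℤ}
    {P : Set (ℝ × ℝ)} (hP : IsCodingPolygon X P) (hV : vertices P = toPlane '' {a, b, c})
    (hPV : P = convexHull ℝ (toPlane '' {a, b, c})) (h0 : orient a b c ≠ 0) :
    ¬ Deterministic X (outerNormal a b c) := by
  intro hdet
  have hsq : 0 < orient a b c * orient a b c := mul_self_pos.2 h0
  have m1 := form_outerNormal_right a c b
  have m2 := form_outerNormal a c b b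
  have n1 := form_outerNormal_right b c a
  have n2 := form_outerNormal b c a a
  have k1 := form_outerNormal_right a b c
  have k2 := form_outerNormal a b c c
  rw [orient_swap, neg_mul_neg] at m2
  rw [orient_rotate] at n2
  have hk := outerNormal_eq_neg a b c
  refine hX (finite_of_deterministic (W := {q | toPlane q ∈ P}) (w := a + b - (c + c))
    (codes_vertex hP hV (a := a) (by simp)) (codes_vertex hP hV (a := b) (by simp))
    (m := outerNormal a c b) (n := outerNormal b c a) ?_ ?_ ?_ ?_
    (fun p q => outerNormal_injective h0) ?_ ?_ (hk ▸ hdet))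
  · refine fun q hq => form_le_of_mem_convexHull (V := {a, b, c}) ?_ (hPV ▸ hq)
    simp only [Set.mem_insert_iff, Set.mem_singleton_iff, forall_eq_or_imp, forall_eq]
    omega
  · refine fun q hq => form_le_of_mem_convexHull (V := {a, b, c}) ?_ (hPV ▸ hq)
    simp only [Set.mem_insert_iff, Set.mem_singleton_iff, forall_eq_or_imp, forall_eq]
    omega
  · rw [hk, form_neg_add, form_neg_add] at k1
    omega
  · intro q hq
    have := form_le_of_mem_convexHull (V := {a, b, c}) (m := outerNormal a b c) (p := q)
      (c := form (outerNormal a b c) a) ?_ (hPV ▸ hq)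
    · rw [hk, form_neg_add, form_neg_add] at this
      omega
    · simp only [Set.mem_insert_iff, Set.mem_singleton_iff, forall_eq_or_imp, forall_eq]
      omega
  · simp only [form_add, form_sub]; omega
  · simp only [form_add, form_sub]; omega

/-- A set of at most three lattice points that has at least two maximizers for each of the outer
normals of a triangle is the vertex set of a homothetic triangle. -/
theorem homothetic_of_maximizers {a b c : ℤ × ℤ} (h0 : orient a b c ≠ 0) {V : Finset (ℤ × ℤ)}
    (hcard : V.card ≤ 3)
    (hab : 1 < (V.filter fun p => ∀ v ∈ V,
      form (outerNormal a b c) v ≤ form (outerNormal a b c) p).card)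
    (hac : 1 < (V.filter fun p => ∀ v ∈ V,
      form (outerNormal a c b) v ≤ form (outerNormal a c b) p).card)
    (hbc : 1 < (V.filter fun p => ∀ v ∈ V,
      form (outerNormal b c a) v ≤ form (outerNormal b c a) p).card) :
    V.card = 3 ∧ ∃ r : ℝ, 0 < r ∧ ∃ w : ℝ × ℝ,
      toPlane '' V = (fun p => r • p + w) '' (toPlane '' {a, b, c}) := by
  classical
  have hsum : ∀ p, form (outerNormal a b c) p + form (outerNormal a c b) p +
      form (outerNormal b c a) p = 0 := by
    intro p; rw [outerNormal_eq_neg a b c, form_neg_add]; ring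
  -- Two subsets with at least two elements each cannot be disjoint among three points.
  have meet : ∀ s t : Finset (ℤ × ℤ), s ⊆ V → t ⊆ V → 1 < s.card → 1 < t.card →
      ∃ p, p ∈ s ∧ p ∈ t := by
    intro s t hs ht hs' ht'
    by_contra! h
    have h1 := Finset.card_union_of_disjoint (Finset.disjoint_left.2 h)
    have h2 := Finset.card_le_card (Finset.union_subset hs ht)
    omega
  obtain ⟨a', ha1, ha2⟩ := meet _ _ (Finset.filter_subset _ _) (Finset.filter_subset _ _) hab hac
  obtain ⟨b', hb1, hb2⟩ := meet _ _ (Finset.filter_subset _ _) (Finset.filter_subset _ _) hab hbc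
  obtain ⟨c', hc1, hc2⟩ := meet _ _ (Finset.filter_subset _ _) (Finset.filter_subset _ _) hac hbc
  simp only [Finset.mem_filter] at ha1 ha2 hb1 hb2 hc1 hc2
  have hV1 : 1 < V.card := hab.trans_le (Finset.card_filter_le _ _)
  -- Since the three forms sum to zero, a common maximizer would give every point of `V` the same
  -- values, leaving only one point.
  have no_common : ∀ p ∈ V, ¬ ((∀ v ∈ V, form (outerNormal a b c) v ≤ form (outerNormal a b c) p) ∧
      (∀ v ∈ V, form (outerNormal a c b) v ≤ form (outerNormal a c b) p) ∧
      (∀ v ∈ V, form (outerNormal b c a) v ≤ form (outerNormal b c a) p)) := by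
    rintro p hp ⟨h1, h2, h3⟩
    obtain ⟨q, hq, hqp⟩ := Finset.exists_mem_ne hV1 p
    have g1 := h1 q hq
    have g2 := h2 q hq
    have g3 := h3 q hq
    have g4 := hsum p
    have g5 := hsum q
    exact hqp (outerNormal_injective h0 (by omega) (by omega))
  have hab' : a' ≠ b' := by rintro rfl; exact no_common a' ha1.1 ⟨ha1.2, ha2.2, hb2.2⟩
  have hac' : a' ≠ c' := by rintro rfl; exact no_common a' ha1.1 ⟨ha1.2, ha2.2, hc2.2⟩
  have hbc' : b' ≠ c' := by rintro rfl; exact no_common b' hb1.1 ⟨hb1.2, hc1.2, hb2.2⟩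
  have hc3 : ({a', b', c'} : Finset (ℤ × ℤ)).card = 3 := Finset.card_eq_three.2
    ⟨a', b', c', hab', hac', hbc', rfl⟩
  have hVeq : {a', b', c'} = V := by
    refine Finset.eq_of_subset_of_card_le ?_ (by omega)
    intro p hp
    simp only [Finset.mem_insert, Finset.mem_singleton] at hp
    rcases hp with rfl | rfl | rfl
    exacts [ha1.1, hb1.1, hc1.1]
  refine ⟨by rw [← hVeq, hc3], ?_⟩
  have e1 := le_antisymm (ha1.2 b' hb1.1) (hb1.2 a' ha1.1)
  have e2 := le_antisymm (ha2.2 c' hc1.1) (hc1.2 a' ha1.1)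
  have e3 := le_antisymm (hb2.2 c' hc1.1) (hc2.2 b' hb1.1)
  have e4 := ha1.2 c' hc1.1
  have hDR : (orient a b c : ℝ) ≠ 0 := by exact_mod_cast h0
  -- coordinates of `b' - a'` and `c' - a'` in the basis `b - a`, `c - a`
  obtain ⟨t, ht⟩ : ∃ t : ℤ, t =
    (b'.1 - a'.1) * (c.2 - a.2) - (b'.2 - a'.2) * (c.1 - a.1) := ⟨_, rfl⟩
  have f1 : (b.1 - a.1) * (b'.2 - a'.2) = (b.2 - a.2) * (b'.1 - a'.1) := by
    apply mul_left_cancel₀ h0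
    simp only [form, outerNormal] at e1; linarith
  have f2 : (c.1 - a.1) * (c'.2 - a'.2) = (c.2 - a.2) * (c'.1 - a'.1) := by
    apply mul_left_cancel₀ h0
    have := orient_swap a b c
    simp only [form, outerNormal, this] at e2; linarith
  have f3 : (c.1 - b.1) * (c'.2 - b'.2) = (c.2 - b.2) * (c'.1 - b'.1) := by
    apply mul_left_cancel₀ h0
    have := orient_rotate a b c
    simp only [form, outerNormal, this] at e3; linarith
  have ht' : t = (b.1 - a.1) * (c'.2 - a'.2) - (b.2 - a.2) * (c'.1 - a'.1) := by
    rw [ht]; linarith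
  have b1 : orient a b c * (b'.1 - a'.1) = t * (b.1 - a.1) := by
    rw [ht, orient]; linear_combination (c.1 - a.1) * f1
  have b2 : orient a b c * (b'.2 - a'.2) = t * (b.2 - a.2) := by
    rw [ht, orient]; linear_combination (c.2 - a.2) * f1
  have c1 : orient a b c * (c'.1 - a'.1) = t * (c.1 - a.1) := by
    rw [ht', orient]; linear_combination (a.1 - b.1) * f2
  have c2 : orient a b c * (c'.2 - a'.2) = t * (c.2 - a.2) := by
    rw [ht', orient]; linear_combination (a.2 - b.2) * f2
  -- The sign comes from `c'` not exceeding `a'` for the outer normal of `ab`; `t = 0` would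
  -- collapse `a'` and `b'`.
  have htpos : 0 < orient a b c * t := by
    refine lt_of_le_of_ne ?_ ?_
    · have : orient a b c * t = form (outerNormal a b c) a' - form (outerNormal a b c) c' := by
        rw [ht']; simp only [form, outerNormal]; ring
      omega
    · intro h
      have ht0 : t = 0 := (mul_eq_zero.1 h.symm).resolve_left h0
      simp only [ht0, zero_mul, mul_eq_zero, h0, false_or] at b1 b2
      exact hab' (Prod.ext (by omega) (by omega))
  refine ⟨t / orient a b c, ?_, toPlane a' - ((t : ℝ) / orient a b c) • toPlane a, ?_⟩
  · have : (0 : ℝ) < orient a b c * t := by exact_mod_cast htpos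
    rw [show (t : ℝ) / orient a b c = orient a b c * t / (orient a b c) ^ 2 by field_simp]
    positivity
  · have hpt : ∀ p q : ℤ × ℤ, orient a b c * (q.1 - a'.1) = t * (p.1 - a.1) →
        orient a b c * (q.2 - a'.2) = t * (p.2 - a.2) →
        ((t : ℝ) / orient a b c) • toPlane p + (toPlane a' - ((t : ℝ) / orient a b c) • toPlane a) =
          toPlane q := by
      intro p q h1 h2
      have h1' : (orient a b c : ℝ) * (q.1 - a'.1) = t * (p.1 - a.1) := by exact_mod_cast h1
      have h2' : (orient a b c : ℝ) * (q.2 - a'.2) = t * (p.2 - a.2) := by exact_mod_cast h2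
      refine Prod.ext ?_ ?_ <;> simp only [toPlane, Prod.fst_add, Prod.snd_add, Prod.smul_fst,
        Prod.smul_snd, Prod.fst_sub, Prod.snd_sub, smul_eq_mul] <;> field_simp <;> linarith
    rw [← hVeq]
    simp only [Finset.coe_insert, Finset.coe_singleton, Set.image_insert_eq, Set.image_singleton]
    rw [hpt a a' (by ring) (by ring), hpt b b' b1 b2, hpt c c' c1 c2]

/-! ### Homotheties and comparison of recoding polygons -/

theorem image_convexHull_homothety (r : ℝ) (w : ℝ × ℝ) (S : Set (ℝ × ℝ)) :
    (fun p => r • p + w) '' convexHull ℝ S = convexHull ℝ ((fun p => r • p + w) '' S) :=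
  AffineMap.image_convexHull (r • AffineMap.id ℝ (ℝ × ℝ) + AffineMap.const ℝ _ w) S

theorem vertices_image_homothety {r : ℝ} (hr : r ≠ 0) (w : ℝ × ℝ) (S : Set (ℝ × ℝ)) :
    vertices ((fun p => r • p + w) '' S) = (fun p => r • p + w) '' vertices S := by
  have key : ∀ x y z : ℝ × ℝ, r • x + w ∈ openSegment ℝ (r • y + w) (r • z + w) ↔
      x ∈ openSegment ℝ y z := by
    intro x y z
    simp only [openSegment, Set.mem_ofPred_eq]
    refine exists_congr fun s => exists_congr fun t => and_congr_right fun _ =>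
      and_congr_right fun _ => and_congr_right fun hst => ?_
    rw [show s • (r • y + w) + t • (r • z + w) = r • (s • y + t • z) + (s + t) • w by module, hst,
      one_smul, add_left_inj, smul_right_inj hr]
  have inj : ∀ x y : ℝ × ℝ, r • x + w = r • y + w ↔ x = y := by
    intro x y; rw [add_left_inj, smul_right_inj hr]
  ext p
  simp only [vertices, Set.extremePoints, Set.mem_image, Set.mem_ofPred_eq]
  constructor
  · rintro ⟨⟨x, hx, rfl⟩, h⟩
    refine ⟨x, ⟨hx, fun y hy z hz hxyz => ?_⟩, rfl⟩
    exact (inj _ _).1 (h ⟨y, hy, rfl⟩ ⟨z, hz, rfl⟩ ((key _ _ _).2 hxyz))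
  · rintro ⟨x, ⟨hx, h⟩, rfl⟩
    refine ⟨⟨x, hx, rfl⟩, ?_⟩
    rintro _ ⟨y, hy, rfl⟩ _ ⟨z, hz, rfl⟩ hxyz
    exact (inj _ _).2 (h hy hz ((key _ _ _).1 hxyz))

theorem numEdges_homothety {r : ℝ} (hr : r ≠ 0) (w : ℝ × ℝ) (S : Set (ℝ × ℝ)) :
    numEdges ((fun p => r • p + w) '' S) = numEdges S := by
  rw [numEdges, vertices_image_homothety hr, numEdges]
  exact Set.ncard_image_of_injective _
    ((add_left_injective w).comp (smul_right_injective _ hr))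

/-- If a recoding of `X` has a triangular coding polygon `P`, then each coding polygon with at most
three edges of another recoding is a triangle homothetic to `P`. -/
theorem homothetic_of_triangle {A : Type u} [TopologicalSpace A] {X : Subshift A (ℤ × ℤ)}
    (hX : X.carrier.Infinite) {P Q : Set (ℝ × ℝ)}
    (hP : P ∈ recodingPolygons X) (hQ : Q ∈ recodingPolygons X) (hP3 : numEdges P = 3)
    (hQ3 : numEdges Q ≤ 3) : numEdges Q = 3 ∧ Homothetic P Q := by
  obtain ⟨B, _, _, _, Y, hY, hPY⟩ := hP
  obtain ⟨C, _, _, _, Z, hZ, hQZ⟩ := hQ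
  obtain ⟨V, hV, hPV, -, hVcard⟩ := hPY.1.exists_finset
  obtain ⟨W, hW, hQW, hWne, hWcard⟩ := hQZ.1.exists_finset
  rw [hP3] at hVcard
  obtain ⟨a, b, c, hab, hac, hbc, rfl⟩ := Finset.card_eq_three.1 hVcard
  simp only [Finset.coe_insert, Finset.coe_singleton] at hV hPV
  have two_max : ∀ a b c : ℤ × ℤ, vertices P = toPlane '' {a, b, c} →
      P = convexHull ℝ (toPlane '' {a, b, c}) → orient a b c ≠ 0 →
      1 < (W.filter fun p => ∀ v ∈ W,
        form (outerNormal a b c) v ≤ form (outerNormal a b c) p).card := by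
    intro a b c hV hPV h0
    have hneg : form (outerNormal a b c) (c - a) < 0 := by
      have : 0 < orient a b c * orient a b c := mul_self_pos.2 h0
      rw [form_sub, form_outerNormal a b c c]
      omega
    refine exists_two_max_of_not_deterministic hQZ hW hQW hWne fun hdet => ?_
    rw [← hZ.deterministic_iff hneg, hY.deterministic_iff hneg] at hdet
    exact not_deterministic_outerNormal (hY.infinite hX) hPY hV hPV h0 hdet
  have h0 := orient_ne_zero hab hac hbc hV
  have s1 : ({a, c, b} : Set (ℤ × ℤ)) = {a, b, c} := by ext; simp; tauto
  have s2 : ({b, c, a} : Set (ℤ × ℤ)) = {a, b, c} := by ext; simp; tauto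
  obtain ⟨hW3, r, hr, w, hrw⟩ := homothetic_of_maximizers h0 (hWcard ▸ hQ3) (two_max a b c hV hPV h0)
    (two_max a c b (s1 ▸ hV) (s1 ▸ hPV) (by rw [orient_swap]; exact neg_ne_zero.2 h0))
    (two_max b c a (s2 ▸ hV) (s2 ▸ hPV) (by rwa [orient_rotate]))
  refine ⟨hWcard ▸ hW3, r, hr, w, ?_⟩
  rw [hPV, image_convexHull_homothety, ← hrw, ← hQW]

/-- Coding is translation invariant, so the same recoding serves; `w` must be integral to preserve
the lattice. -/
theorem image_translate_mem_recodingPolygons {A : Type u} [TopologicalSpace A]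
    {X : Subshift A (ℤ × ℤ)} {Q : Set (ℝ × ℝ)} (hQ : Q ∈ recodingPolygons X) (w : ℤ × ℤ) :
    (fun p => p + toPlane w) '' Q ∈ recodingPolygons X := by
  classical
  obtain ⟨B, i₁, i₂, i₃, Y, hY, ⟨S, hS, hQS⟩, hcode⟩ := hQ
  have hone : (fun p : ℝ × ℝ => p + toPlane w) = fun p => (1 : ℝ) • p + toPlane w := by
    funext p; rw [one_smul]
  refine ⟨B, i₁, i₂, i₃, Y, hY, ⟨S.image (· + w), ?_, ?_⟩, ?_⟩
  · obtain ⟨p, hp, q, hq, hpq⟩ := hS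
    exact ⟨p + w, by simpa using hp, q + w, by simpa using hq, by simpa using hpq⟩
  · rw [hone, hQS, image_convexHull_homothety, ← hone, Finset.coe_image, Set.image_image,
      Set.image_image]
    simp only [toPlane_add]
  · rw [hone, vertices_image_homothety one_ne_zero, ← hone]
    rintro _ ⟨z, hz, rfl⟩ x hx x' hx' hag p hp
    have := hcode z hz _ (Y.mapsTo w hx) _ (Y.mapsTo w hx') (fun q hq => by
      refine hag (w + q) ⟨⟨toPlane q, hq.1, ?_⟩, ?_⟩
      · rw [toPlane_add, add_comm]
      · rw [toPlane_add, add_comm]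
        exact fun h => hq.2 (add_right_cancel h)) (p - w) (by
        have h : toPlane p = z + toPlane w := hp
        rw [← sub_add_cancel p w, toPlane_add] at h
        exact add_right_cancel h)
    simpa [shift] using this

/-! ### Minimality and translations -/

theorem IsMinimalRecodingPolygon.numEdges_eq {A : Type u} [TopologicalSpace A]
    {X : Subshift A (ℤ × ℤ)} {P Q : Set (ℝ × ℝ)} (hP : IsMinimalRecodingPolygon X P)
    (hQ : IsMinimalRecodingPolygon X Q) : numEdges P = numEdges Q :=
  le_antisymm (hP.2.1 Q hQ.1) (hQ.2.1 P hP.1)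

theorem isConvexIntegerPolygon_of_mem_recodingPolygons {A : Type u} [TopologicalSpace A]
    {X : Subshift A (ℤ × ℤ)} {P : Set (ℝ × ℝ)} (hP : P ∈ recodingPolygons X) :
    IsConvexIntegerPolygon P := by
  obtain ⟨B, _, _, _, Y, -, hPY⟩ := hP
  exact hPY.1

theorem differByTranslation_of_le_one {A : Type u} [TopologicalSpace A]
    {X : Subshift A (ℤ × ℤ)} {P Q : Set (ℝ × ℝ)} (hP : IsMinimalRecodingPolygon X P)
    (hQ : IsMinimalRecodingPolygon X Q) {r : ℝ} (hr : 0 < r) (hr1 : r ≤ 1) {w : ℝ × ℝ}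
    (hPQ : Q = (fun p => r • p + w) '' P) :
    ∃ v : ℝ × ℝ, P = (fun p => p + v) '' Q := by
  obtain ⟨V, hV, hPV, ⟨a, ha⟩, -⟩ :=
    (isConvexIntegerPolygon_of_mem_recodingPolygons hP.1).exists_finset
  obtain ⟨W, hW, -, -, -⟩ := (isConvexIntegerPolygon_of_mem_recodingPolygons hQ.1).exists_finset
  have haP : toPlane a ∈ vertices P := hV ▸ Set.mem_image_of_mem _ ha
  obtain ⟨b, -, hb⟩ : r • toPlane a + w ∈ toPlane '' (W : Set (ℤ × ℤ)) := by
    rw [← hW, hPQ, vertices_image_homothety hr.ne']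
    exact Set.mem_image_of_mem _ haP
  have hab : toPlane (a - b) = toPlane a - (r • toPlane a + w) := by
    rw [← hb]; simp [toPlane]
  have hone : (fun p : ℝ × ℝ => p + toPlane (a - b)) = fun p => (1 : ℝ) • p + toPlane (a - b) := by
    funext p; rw [one_smul]
  refine ⟨toPlane (a - b), (hP.2.2 _ (image_translate_mem_recodingPolygons hQ.1 (a - b)) ?_ ?_).symm⟩
  · rw [hone, numEdges_homothety one_ne_zero, hP.numEdges_eq hQ]
  · rw [hPQ, hab]
    rintro _ ⟨_, ⟨p, hp, rfl⟩, rfl⟩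
    have hconv : Convex ℝ P := by rw [hPV]; exact convex_convexHull ℝ _
    -- The moved copy is the contraction of `P` about its vertex `a` by the factor `r ≤ 1`.
    have := hconv hp haP.1 hr.le (sub_nonneg.2 hr1) (by ring)
    convert this using 1
    module

theorem differByTranslation_of_homothetic {A : Type u} [TopologicalSpace A]
    {X : Subshift A (ℤ × ℤ)} {P Q : Set (ℝ × ℝ)} (hP : IsMinimalRecodingPolygon X P)
    (hQ : IsMinimalRecodingPolygon X Q) (h : Homothetic P Q) : DifferByTranslation P Q := by
  obtain ⟨r, hr, w, hPQ⟩ := h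
  rcases le_total r 1 with hr1 | hr1
  · obtain ⟨v, hv⟩ := differByTranslation_of_le_one hP hQ hr hr1 hPQ
    refine ⟨-v, ?_⟩
    rw [hv, Set.image_image]
    simp
  · refine differByTranslation_of_le_one hQ hP (inv_pos.2 hr) (inv_le_one_of_one_le₀ hr1)
      (w := -(r⁻¹ • w)) ?_
    rw [hPQ, Set.image_image]
    simp [smul_smul, inv_mul_cancel₀ hr.ne']

end PolygonalShift

theorem corollary5p15 {A : Type*} [Finite A] [TopologicalSpace A] [DiscreteTopology A]
    (X : SymbolicDynamics.FullShift.Subshift A (ℤ × ℤ)) (hX : PolygonalShift.IsPolygonal X) :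
    (∀ P Q : Set (ℝ × ℝ),
      PolygonalShift.IsMinimalRecodingPolygon X P →
      PolygonalShift.IsMinimalRecodingPolygon X Q →
      PolygonalShift.Homothetic P Q → PolygonalShift.DifferByTranslation P Q) ∧
    (PolygonalShift.IsTriangular X →
      ∀ P Q : Set (ℝ × ℝ),
        PolygonalShift.IsMinimalRecodingPolygon X P →
        PolygonalShift.IsMinimalRecodingPolygon X Q →
        PolygonalShift.DifferByTranslation P Q) := by
  refine ⟨fun P Q hP hQ h => PolygonalShift.differByTranslation_of_homothetic hP hQ h, ?_⟩
  rintro ⟨-, T, hT, hT3⟩ P Q hP hQ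
  have hTX : T ∈ PolygonalShift.recodingPolygons X :=
    ⟨A, inferInstance, inferInstance, inferInstance, X, .refl X, hT⟩
  -- The triangle `T` serves to bound the number of edges and to show that `P` is a triangle; then
  -- `P` and `Q` are compared directly.
  have hP3 := (PolygonalShift.homothetic_of_triangle hX.1 hTX hP.1 hT3 (hT3 ▸ hP.2.1 T hTX)).1
  have hQ3 : PolygonalShift.numEdges Q ≤ 3 := hT3 ▸ hQ.2.1 T hTX
  exact PolygonalShift.differByTranslation_of_homothetic hP hQ
    (PolygonalShift.homothetic_of_triangle hX.1 hP.1 hQ.1 hP3 hQ3).2
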